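/- Let $K$ be a field. An arithmetic formula over $K$ is a binary tree whose leaves are labelled by variables or elements of $K$ and whose inner nodes are $+$ or $\times$ gates. It is a read-once formula (ROF) if each variable labels at most one leaf, and a polynomial computed by an ROF is a read-once polynomial (ROP). Multiplications by a constant (a subformula without variables) are regarded as coefficients and are ignored when speaking of parents and of paths of gates. For a gate $v$ of an ROF $F$, let the sum-fan-in of $v$ be the number of variables in the sub-formula rooted at $v$ whose parent is a $+$ gate. Let $s_F$ be the maximum of the sum-fan-in of $v$ over all $+$ gates $v$ of $F$ outside the top layer of $+$ gates, i.e. outside the set of those $+$ gates that are joined to the output of $F$ by $+$ gates only ($s_F=0$ if there is no such $v$). For an ROP $f$, let $s_f$ be the smallest value of $s_F$ among all ROFs $F$ computing $f$. Let $\mathrm{perm}_n=\sum_{\sigma\in S_n}\prod_{i=1}^n x_{i,\sigma(i)}$. Theorem. There are constants $\varepsilon>0$, $c>0$ and $n_0$ such that the following holds for every field $K$, every $n\ge n_0$ with $N=n^2$, every real $\lambda\le 1/30$, all $s,t\in\mathbb N$ with $t\le N^{1/30}$, and all ROPs $f_{i,j}$ ($1\le i\le s$, $1\le j\le t$) over $K$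 in the $N$ variables $x_{1,1},\dots,x_{n,n}$ with $s_{f_{i,j}}\le N^{1/2+\lambda}$: if $$\sum_{i=1}^{s}\prod_{j=1}^{t} f_{i,j}=\mathrm{perm}_n,$$ then $s\ge 2^{cN^{\varepsilon}}$, i.e. $s=2^{\Omega(N^{\varepsilon})}$. -/

import Mathlib

/-- Arithmetic formulas over the field `K` in the variables `σ`: binary trees whose leaves are
labelled by variables or field elements and whose inner nodes are `+` or `×` gates. -/
inductive ArithFormula (σ : Type*) (K : Type*) where
  | const (a : K) : ArithFormula σ K
  | var (x : σ) : ArithFormula σ K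
  | add (l r : ArithFormula σ K) : ArithFormula σ K
  | mul (l r : ArithFormula σ K) : ArithFormula σ K

namespace ArithFormula

variable {σ K : Type*}

/-- The polynomial computed by (the output gate of) a formula. -/
noncomputable def poly [CommSemiring K] : ArithFormula σ K → MvPolynomial σ K
  | const a => MvPolynomial.C a
  | var x => MvPolynomial.X x
  | add l r => l.poly + r.poly
  | mul l r => l.poly * r.poly

/-- The variables labelling the leaves of a formula, with multiplicity. -/
def leafVars : ArithFormula σ K → Multiset σ
  | const _ => 0
  | var x => {x}
  | add l r => l.leafVars + r.leafVars
  | mul l r => l.leafVars + r.leafVars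

/-- A read-once formula: every variable labels at most one leaf. -/
def ReadOnce (Φ : ArithFormula σ K) : Prop := Φ.leafVars.Nodup

/-- The formula has no variable leaf, so it is just a field constant. -/
def isConst : ArithFormula σ K → Bool
  | const _ => true
  | var _ => false
  | add l r => l.isConst && r.isConst
  | mul l r => l.isConst && r.isConst

/-- The number of variable leaves of `Φ` whose parent is a `+` gate. The flag `b` tells whether the
parent of the root of `Φ` is a `+` gate. A product with a constant is a coefficient and does not
count as a parent: in `3 * x + 5 * y` the parent of `x` and of `y` is the `+` gate. -/
def sumLeaves : Bool → ArithFormula σ K → ℕ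
  | _, const _ => 0
  | b, var _ => if b then 1 else 0
  | _, add l r => l.sumLeaves true + r.sumLeaves true
  | b, mul l r =>
      if l.isConst || r.isConst then l.sumLeaves b + r.sumLeaves b
      else l.sumLeaves false + r.sumLeaves false
termination_by structural _ Φ => Φ

/-- The sum-fan-in of the root gate `v` of `Φ`: the number of variables in the sub-formula rooted at
`v` whose parents are labelled `+`. -/
def sumFanIn (Φ : ArithFormula σ K) : ℕ := Φ.sumLeaves false

/-- The maximum of the sum-fan-in over all `+` gates of the formula (`0` if there is none). -/
def maxSumFanIn : ArithFormula σ K → ℕ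
  | const _ => 0
  | var _ => 0
  | add l r => max (sumFanIn (add l r)) (max l.maxSumFanIn r.maxSumFanIn)
  | mul l r => max l.maxSumFanIn r.maxSumFanIn

/-- `s_Φ`: the maximum of the sum-fan-in over all `+` gates of `Φ` outside the top layer of `+`
gates. The top layer consists of the `+` gates which are joined to the output by `+` gates only
(that is, the output sum, whose fan-in is spread over several binary gates); here again a product
with a constant is a coefficient and not a gate. -/
def innerSumFanIn : ArithFormula σ K → ℕ
  | const _ => 0
  | var _ => 0
  | add l r => max l.innerSumFanIn r.innerSumFanIn
  | mul l r =>
      if l.isConst || r.isConst then max l.innerSumFanIn r.innerSumFanIn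
      else max l.maxSumFanIn r.maxSumFanIn

end ArithFormula

/-- A read-once polynomial: a polynomial computed by a read-once formula. -/
def IsROP {σ K : Type*} [CommSemiring K] (f : MvPolynomial σ K) : Prop :=
  ∃ Φ : ArithFormula σ K, Φ.ReadOnce ∧ Φ.poly = f

/-- `s_f` for a read-once polynomial `f`: the smallest value of `s_Φ` among all read-once formulas
`Φ` that compute `f`. -/
noncomputable def ropSumFanIn {σ K : Type*} [CommSemiring K] (f : MvPolynomial σ K) : ℕ :=
  sInf {k : ℕ | ∃ Φ : ArithFormula σ K, Φ.ReadOnce ∧ Φ.poly = f ∧ Φ.innerSumFanIn = k}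

/-- The permanent polynomial of the `n × n` matrix of distinct variables. -/
noncomputable def permPoly (n : ℕ) (K : Type*) [CommRing K] : MvPolynomial (Fin n × Fin n) K :=
  (Matrix.mvPolynomialX (Fin n) (Fin n) K).permanent

/-! Fix a set `Z` of variables, regard polynomials as having coefficients in `K[Z]`, and measure the
dimension of the span of the coefficients of degree at most `k` outside `Z`. `Z` consists of the
diagonal and the rows and columns of `k` hubs, so it has only O(kn) elements.

Upper bound: a subformula without `Z`-leaves has scalar coefficients and costs nothing, so a formula
with `D` leaves in `Z` has measure at most `(3D+1)^k` (`ArithFormula.hasCoeffSpan`). A product of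
`t` ROPs has `D ≤ t|Z|`, and the measure is subadditive over the `s` summands
(`exists_span_sum_prod`).

Lower bound: take permutations made of `k` disjoint 3-cycles hub → left → right → hub, with `m`
choices each of the left and the right point. Only left → right lies outside `Z`, and the part in
`Z` also determines both points. Hence the permanent has `m^(2k)` independent coefficients
(`linearIndependent_coeff_permPoly`, `eq_of_permExponent_embCycles`).

With `m ≈ n/(3k)`, the ratio of the bases is of order at least `n/(t k^3)`; for `k ≈ n^(1/10)` it is
at least 2, so `s ≥ 2^k`. -/

open MvPolynomial Pointwise

/-! ### Spans of low-degree coefficients -/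

/-- View a polynomial in the variables `σ` as a polynomial in the variables outside `Z` whose
coefficients are polynomials in the variables of `Z`. -/
noncomputable def splitVars {σ : Type*} (K : Type*) [CommRing K] (Z : σ → Prop) [DecidablePred Z] :
    MvPolynomial σ K →ₐ[K] MvPolynomial σ (MvPolynomial σ K) :=
  aeval fun x => if Z x then C (X x) else X x

/-- The coefficients of degree at most `j` of `p` lie in a space spanned by `m ^ j` elements,
which contains `1` if `j ≠ 0`. -/
def HasCoeffSpan {σ R : Type*} (K : Type*) [CommRing K] [CommRing R] [Algebra K R] (m : ℕ)
    (p : MvPolynomial σ R) : Prop :=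
  ∃ V : ℕ → Finset R, (∀ j, (V j).card ≤ m ^ j) ∧
    (∀ j, j ≠ 0 → (1 : R) ∈ Submodule.span K (V j : Set R)) ∧
    ∀ j (α : σ →₀ ℕ), α.degree ≤ j → coeff α p ∈ Submodule.span K (V j : Set R)

section CoeffSpan

variable {σ R K : Type*} [CommRing K] [CommRing R] [Algebra K R] {p q : MvPolynomial σ R} {m l : ℕ}

lemma HasCoeffSpan.mono (hp : HasCoeffSpan K m p) (h : m ≤ l) : HasCoeffSpan K l p := by
  obtain ⟨V, hc, h1, hV⟩ := hp
  exact ⟨V, fun j => (hc j).trans (Nat.pow_le_pow_left h j), h1, hV⟩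

lemma one_le_span_of_mem {S : Submodule K R} (h : (1 : R) ∈ S) : (1 : Submodule K R) ≤ S := by
  rwa [Submodule.one_le]

lemma hasCoeffSpan_one (hp : ∀ α, coeff α p ∈ (1 : Submodule K R)) : HasCoeffSpan K 1 p := by
  classical
  refine ⟨fun _ => {1}, fun j => by simp, fun j _ => Submodule.subset_span (by simp), ?_⟩
  intro j α _
  rw [Finset.coe_singleton, ← Submodule.one_eq_span]
  exact hp α

/-- For `j ≠ 0` a union suffices, as `m^j + l^j ≤ (m+l)^j`. This fails at `j = 0`, where the single
constant coefficient is used instead. -/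
lemma HasCoeffSpan.add (hp : HasCoeffSpan K m p) (hq : HasCoeffSpan K l q) :
    HasCoeffSpan K (m + l) (p + q) := by
  classical
  obtain ⟨V, hVc, hV1, hV⟩ := hp
  obtain ⟨W, hWc, hW1, hW⟩ := hq
  refine ⟨fun j => if j = 0 then {coeff 0 p + coeff 0 q} else V j ∪ W j, ?_, ?_, ?_⟩
  · intro j
    rcases eq_or_ne j 0 with rfl | hj
    · simp
    · simp only [hj, if_false]
      calc _ ≤ _ := Finset.card_union_le _ _
        _ ≤ m ^ j + l ^ j := add_le_add (hVc j) (hWc j)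
        _ ≤ _ := pow_add_pow_le (Nat.zero_le _) (Nat.zero_le _) hj
  · intro j hj
    simp only [hj, if_false, Finset.coe_union]
    exact Submodule.span_mono Set.subset_union_left (hV1 j hj)
  · intro j α hα
    rcases eq_or_ne j 0 with rfl | hj
    · obtain rfl : α = 0 := (Finsupp.degree_eq_zero_iff α).1 (Nat.le_zero.1 hα)
      simp
    · simp only [hj, if_false, Finset.coe_union, coeff_add]
      exact add_mem (Submodule.span_mono Set.subset_union_left (hV j α hα))
        (Submodule.span_mono Set.subset_union_right (hW j α hα))

/-- Products of spanning sets over all splittings of `j` number at most `∑ m^a l^(j-a) ≤ (m+l)^j` by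
the binomial theorem. The extra 1 in the base pays for adjoining `1`. -/
lemma HasCoeffSpan.mul (hp : HasCoeffSpan K m p) (hq : HasCoeffSpan K l q) :
    HasCoeffSpan K (m + l + 1) (p * q) := by
  classical
  obtain ⟨V, hVc, hV1, hV⟩ := hp
  obtain ⟨W, hWc, hW1, hW⟩ := hq
  have hmem : ∀ j, ∀ x ∈ Finset.HasAntidiagonal.antidiagonal j, (V x.1 * W x.2 : Finset R) ⊆
      (Finset.HasAntidiagonal.antidiagonal j).biUnion fun x => V x.1 * W x.2 := fun j x hx =>
    Finset.subset_biUnion_of_mem (fun x : ℕ × ℕ => V x.1 * W x.2) hx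
  have hcard : ∀ j, ((Finset.HasAntidiagonal.antidiagonal j).biUnion fun x => V x.1 * W x.2).card ≤
      (m + l) ^ j := by
    intro j
    calc _ ≤ ∑ x ∈ Finset.HasAntidiagonal.antidiagonal j, (V x.1 * W x.2).card := Finset.card_biUnion_le
      _ ≤ ∑ x ∈ Finset.HasAntidiagonal.antidiagonal j, j.choose x.1 * (m ^ x.1 * l ^ x.2) := by
        refine Finset.sum_le_sum fun x hx => ?_
        have hx' : x.1 ≤ j := Finset.HasAntidiagonal.antidiagonal.fst_le hx
        calc _ ≤ (V x.1).card * (W x.2).card := Finset.card_mul_le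
          _ ≤ m ^ x.1 * l ^ x.2 := Nat.mul_le_mul (hVc _) (hWc _)
          _ ≤ _ := Nat.le_mul_of_pos_left _ (Nat.choose_pos hx')
      _ = _ := by
        rw [(Commute.all m l).add_pow']
        simp
  refine ⟨fun j => ((Finset.HasAntidiagonal.antidiagonal j).biUnion fun x => V x.1 * W x.2) ∪
    (if j = 0 then ∅ else {1}), ?_, ?_, ?_⟩
  · intro j
    rcases eq_or_ne j 0 with rfl | hj
    · simpa using hcard 0
    · simp only [hj, if_false]
      calc _ ≤ _ := Finset.card_union_le _ _
        _ ≤ (m + l) ^ j + 1 ^ j := add_le_add (hcard j) (by simp)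
        _ ≤ _ := pow_add_pow_le (Nat.zero_le _) (Nat.zero_le _) hj
  · intro j hj
    exact Submodule.subset_span (by simp [hj])
  · intro j α hα
    rw [coeff_mul]
    refine Submodule.sum_mem _ fun x hx => ?_
    rw [Finset.HasAntidiagonal.mem_antidiagonal] at hx
    have hdeg : x.1.degree + x.2.degree = α.degree := by rw [← hx, map_add]
    -- The first factor uses its exact degree and the second takes all the remaining budget, so the
    -- two indices add up to `j`.
    have h1 := Submodule.mul_mem_mul (hV x.1.degree x.1 le_rfl)
      (hW (j - x.1.degree) x.2 (by omega))
    rw [Submodule.span_mul_span, ← Finset.coe_mul] at h1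
    refine Submodule.span_mono ?_ h1
    rw [Finset.coe_subset]
    exact (hmem j (x.1.degree, j - x.1.degree) (by simp; omega)).trans Finset.subset_union_left

lemma HasCoeffSpan.mul_scalar (hp : HasCoeffSpan K m p)
    (hq : ∀ α, coeff α q ∈ (1 : Submodule K R)) : HasCoeffSpan K m (p * q) := by
  classical
  obtain ⟨V, hVc, hV1, hV⟩ := hp
  refine ⟨V, hVc, hV1, fun j α hα => ?_⟩
  rw [coeff_mul]
  refine Submodule.sum_mem _ fun x hx => ?_
  rw [Finset.HasAntidiagonal.mem_antidiagonal] at hx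
  have hdeg : x.1.degree + x.2.degree = α.degree := by rw [← hx, map_add]
  have h1 := Submodule.mul_mem_mul (hV j x.1 (by omega)) (hq x.2)
  rwa [mul_one] at h1

/-- Scalars are absorbed by the `1` kept in every span with `j ≠ 0`; this is what that condition is
for. -/
lemma HasCoeffSpan.add_scalar (hp : HasCoeffSpan K m p)
    (hq : ∀ α, coeff α q ∈ (1 : Submodule K R)) : HasCoeffSpan K m (p + q) := by
  classical
  obtain ⟨V, hVc, hV1, hV⟩ := hp
  refine ⟨fun j => if j = 0 then {coeff 0 p + coeff 0 q} else V j, ?_, ?_, ?_⟩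
  · intro j
    rcases eq_or_ne j 0 with rfl | hj
    · simp
    · simpa [hj] using hVc j
  · intro j hj
    simpa [hj] using hV1 j hj
  · intro j α hα
    rcases eq_or_ne j 0 with rfl | hj
    · obtain rfl : α = 0 := (Finsupp.degree_eq_zero_iff α).1 (Nat.le_zero.1 hα)
      simp
    · simp only [hj, if_false, coeff_add]
      exact add_mem (hV j α hα) (one_le_span_of_mem (hV1 j hj) (hq α))

end CoeffSpan

lemma coeff_monomial_C_mem_one {σ K : Type*} [CommRing K] (α β : σ →₀ ℕ) (a : K) :
    coeff α (monomial β (C a : MvPolynomial σ K)) ∈ (1 : Submodule K (MvPolynomial σ K)) := by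
  classical
  rw [coeff_monomial]
  split_ifs
  · exact Submodule.mem_one.2 ⟨a, rfl⟩
  · exact zero_mem _

/-! ### Measure of formulas with few leaves in `Z` -/

section Formula

variable {σ K : Type*} [CommRing K] (Z : σ → Prop) [DecidablePred Z]

lemma ArithFormula.coeff_splitVars_mem_one (Φ : ArithFormula σ K) (h : Φ.leafVars.countP Z = 0)
    (α : σ →₀ ℕ) :
    coeff α (splitVars K Z Φ.poly) ∈ (1 : Submodule K (MvPolynomial σ K)) := by
  classical
  induction Φ generalizing α with
  | const a =>
    have : splitVars K Z (C a) = monomial 0 (C a) := by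
      rw [splitVars, MvPolynomial.aeval_C]; rfl
    rw [ArithFormula.poly, this]
    exact coeff_monomial_C_mem_one α 0 a
  | var x =>
    have hx : ¬ Z x := by simpa [ArithFormula.leafVars, Multiset.countP_eq_zero] using h
    have : splitVars K Z (X x) = monomial (Finsupp.single x 1) (C 1) := by
      rw [splitVars, aeval_X, if_neg hx, C_1]; rfl
    rw [ArithFormula.poly, this]
    exact coeff_monomial_C_mem_one α _ 1
  | add l r hl hr =>
    simp only [ArithFormula.leafVars, Multiset.countP_add, Nat.add_eq_zero_iff] at h
    rw [ArithFormula.poly, map_add, coeff_add]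
    exact add_mem (hl h.1 α) (hr h.2 α)
  | mul l r hl hr =>
    simp only [ArithFormula.leafVars, Multiset.countP_add, Nat.add_eq_zero_iff] at h
    rw [ArithFormula.poly, map_mul, coeff_mul]
    refine Submodule.sum_mem _ fun x _ => ?_
    have := Submodule.mul_mem_mul (hl h.1 x.1) (hr h.2 x.2)
    rwa [mul_one] at this

/-- A `Z`-leaf costs 2 (the elements `1` and `X x`), and a product of two parts that both meet `Z`
costs 1 more: `(3a-1) + (3b-1) + 1 = 3(a+b) - 1`. -/
lemma ArithFormula.hasCoeffSpan_of_countP_ne_zero (Φ : ArithFormula σ K)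
    (h : Φ.leafVars.countP Z ≠ 0) :
    HasCoeffSpan K (3 * Φ.leafVars.countP Z - 1) (splitVars K Z Φ.poly) := by
  classical
  induction Φ with
  | const a => simp [ArithFormula.leafVars] at h
  | var x =>
    have hx : Z x := by
      by_contra hx
      exact h (by simpa [ArithFormula.leafVars, Multiset.countP_eq_zero] using hx)
    have hcount : ({x} : Multiset σ).countP Z = 1 := by
      rw [← Multiset.cons_zero, Multiset.countP_cons_of_pos _ hx, Multiset.countP_zero]
    rw [ArithFormula.leafVars, hcount, ArithFormula.poly, splitVars, aeval_X, if_pos hx]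
    refine ⟨fun j => if j = 0 then {X x} else {1, X x}, ?_, ?_, ?_⟩
    · intro j
      rcases eq_or_ne j 0 with rfl | hj
      · simp
      · simp only [hj, if_false]
        exact Finset.card_le_two.trans (Nat.le_self_pow hj 2)
    · intro j hj
      exact Submodule.subset_span (by simp [hj])
    · intro j α _
      rw [coeff_C]
      split_ifs
      · exact Submodule.subset_span (by rcases eq_or_ne j 0 with rfl | hj <;> simp [*])
      · exact zero_mem _
  | add l r hl hr =>
    simp only [ArithFormula.leafVars, Multiset.countP_add] at h ⊢
    rw [ArithFormula.poly, map_add]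
    by_cases h1 : l.leafVars.countP Z = 0
    · rw [h1, zero_add] at h ⊢
      rw [add_comm]
      exact (hr h).add_scalar (l.coeff_splitVars_mem_one Z h1)
    by_cases h2 : r.leafVars.countP Z = 0
    · rw [h2, add_zero]
      exact (hl h1).add_scalar (r.coeff_splitVars_mem_one Z h2)
    exact ((hl h1).add (hr h2)).mono (by omega)
  | mul l r hl hr =>
    simp only [ArithFormula.leafVars, Multiset.countP_add] at h ⊢
    rw [ArithFormula.poly, map_mul]
    by_cases h1 : l.leafVars.countP Z = 0
    · rw [h1, zero_add] at h ⊢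
      rw [mul_comm (splitVars K Z l.poly)]
      exact (hr h).mul_scalar (l.coeff_splitVars_mem_one Z h1)
    by_cases h2 : r.leafVars.countP Z = 0
    · rw [h2, add_zero]
      exact (hl h1).mul_scalar (r.coeff_splitVars_mem_one Z h2)
    exact ((hl h1).mul (hr h2)).mono (by omega)

/-- A formula with at most `D` leaves labelled by variables of `Z` has few independent
coefficients of low degree outside `Z`. -/
lemma ArithFormula.hasCoeffSpan (Φ : ArithFormula σ K) {D : ℕ} (h : Φ.leafVars.countP Z ≤ D) :
    HasCoeffSpan K (3 * D + 1) (splitVars K Z Φ.poly) := by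
  by_cases h0 : Φ.leafVars.countP Z = 0
  · exact (hasCoeffSpan_one (Φ.coeff_splitVars_mem_one Z h0)).mono (by omega)
  · exact (Φ.hasCoeffSpan_of_countP_ne_zero Z h0).mono (by omega)

lemma ArithFormula.ReadOnce.countP_le {τ L : Type*} [Fintype τ] (Z : τ → Prop) [DecidablePred Z]
    {Φ : ArithFormula τ L} (h : Φ.ReadOnce) :
    Φ.leafVars.countP Z ≤ (Finset.univ.filter Z).card := by
  classical
  rw [Multiset.countP_eq_card_filter]
  exact Multiset.card_le_card ((Multiset.le_iff_subset (Multiset.Nodup.filter _ h)).2 (by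
    intro x hx
    simpa using (Multiset.mem_filter.1 hx).2))

/-- A product of read-once polynomials is computed by a formula reading every variable at most
once per factor. -/
lemma exists_formula_prod [Fintype σ] {ι : Type*} (S : Finset ι) (f : ι → MvPolynomial σ K)
    (hf : ∀ j, IsROP (f j)) :
    ∃ Φ : ArithFormula σ K, Φ.poly = ∏ j ∈ S, f j ∧
      Φ.leafVars.countP Z ≤ S.card * (Finset.univ.filter Z).card := by
  classical
  induction S using Finset.induction_on with
  | empty => exact ⟨.const 1, by simp [ArithFormula.poly], by simp [ArithFormula.leafVars]⟩
  | insert a S ha ih =>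
    obtain ⟨Φ, h1, h2⟩ := ih
    obtain ⟨Ψ, h3, h4⟩ := hf a
    refine ⟨.mul Ψ Φ, by rw [ArithFormula.poly, h1, h4, Finset.prod_insert ha], ?_⟩
    rw [ArithFormula.leafVars, Multiset.countP_add, Finset.card_insert_of_notMem ha]
    have := ArithFormula.ReadOnce.countP_le Z h3
    nlinarith

/-- The coefficients of degree at most `k` of a sum of `s` products of `t` read-once polynomials
lie in a space of small dimension. -/
lemma exists_span_sum_prod [Fintype σ] {s t : ℕ} (f : Fin s → Fin t → MvPolynomial σ K)
    (hf : ∀ i j, IsROP (f i j)) (k : ℕ) :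
    ∃ V : Finset (MvPolynomial σ K),
      V.card ≤ s * (3 * (t * (Finset.univ.filter Z).card) + 1) ^ k ∧
      ∀ α : σ →₀ ℕ, α.degree ≤ k →
        coeff α (splitVars K Z (∑ i, ∏ j, f i j)) ∈
          Submodule.span K (V : Set (MvPolynomial σ K)) := by
  classical
  have h : ∀ i, HasCoeffSpan K (3 * (t * (Finset.univ.filter Z).card) + 1)
      (splitVars K Z (∏ j, f i j)) := by
    intro i
    obtain ⟨Φ, h1, h2⟩ := exists_formula_prod Z Finset.univ (f i) (hf i)
    rw [← h1]
    exact Φ.hasCoeffSpan Z (by simpa using h2)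
  choose V hVc _ hV using h
  refine ⟨Finset.univ.biUnion fun i => V i k, ?_, ?_⟩
  · refine Finset.card_biUnion_le.trans ((Finset.sum_le_card_nsmul _ _ _ fun i _ => hVc i k).trans ?_)
    simp
  · intro α hα
    rw [map_sum, coeff_sum]
    refine Submodule.sum_mem _ fun i _ => Submodule.span_mono ?_ (hV i k α hα)
    rw [Finset.coe_subset]
    exact Finset.subset_biUnion_of_mem (fun i => V i k) (Finset.mem_univ i)

end Formula

/-! ### Independent coefficients of the permanent -/

section Permanent

variable {n : ℕ} (Z : Fin n × Fin n → Prop) [DecidablePred Z]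

/-- The exponent of the part of the permutation monomial of `π` in the variables satisfying `Z`. -/
noncomputable def permExponent (π : Equiv.Perm (Fin n)) : Fin n × Fin n →₀ ℕ :=
  ∑ i with Z (π i, i), Finsupp.single (π i, i) 1

lemma permExponent_apply (π : Equiv.Perm (Fin n)) (a i : Fin n) :
    permExponent Z π (a, i) = if Z (a, i) ∧ π i = a then 1 else 0 := by
  classical
  rw [permExponent, Finsupp.finsetSum_apply, Finset.sum_filter]
  rw [Finset.sum_eq_single i]
  · by_cases h : π i = a
    · subst h; simp
    · simp [h]
  · intro j _ hj
    simp [hj]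
  · simp

lemma apply_eq_of_permExponent_eq {π ρ : Equiv.Perm (Fin n)}
    (h : permExponent Z π = permExponent Z ρ) {i : Fin n} (hi : Z (ρ i, i)) : π i = ρ i := by
  have := DFunLike.congr_fun h (ρ i, i)
  rw [permExponent_apply, permExponent_apply, if_pos (c := Z (ρ i, i) ∧ ρ i = ρ i) ⟨hi, rfl⟩]
    at this
  by_contra hne
  rw [if_neg fun hc => hne hc.2] at this
  exact zero_ne_one this

lemma eq_of_permExponent_eq {π ρ : Equiv.Perm (Fin n)}
    (h : permExponent Z π = permExponent Z ρ)
    (h' : permExponent (fun x => ¬ Z x) π = permExponent (fun x => ¬ Z x) ρ) : π = ρ := by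
  ext1 i
  by_cases hi : Z (ρ i, i)
  · exact apply_eq_of_permExponent_eq Z h hi
  · exact apply_eq_of_permExponent_eq (fun x => ¬ Z x) h' hi

lemma degree_permExponent (π : Equiv.Perm (Fin n)) :
    (permExponent Z π).degree = (Finset.univ.filter fun i => Z (π i, i)).card := by
  rw [permExponent, map_sum]
  simp [Finsupp.degree_single]

lemma splitVars_permPoly (K : Type*) [CommRing K] :
    splitVars K Z (permPoly n K) = ∑ π : Equiv.Perm (Fin n),
      monomial (permExponent (fun x => ¬ Z x) π) (monomial (permExponent Z π) (1 : K)) := by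
  classical
  rw [permPoly, Matrix.permanent, map_sum]
  refine Finset.sum_congr rfl fun π _ => ?_
  have h1 : (monomial (permExponent Z π) (1 : K)) = ∏ i with Z (π i, i), X (π i, i) := by
    rw [permExponent, monomial_sum_one]; rfl
  have h2 : (monomial (permExponent (fun x => ¬ Z x) π) (1 : MvPolynomial (Fin n × Fin n) K)) =
      ∏ i with ¬ Z (π i, i), X (π i, i) := by
    rw [permExponent, monomial_sum_one]; rfl
  rw [← mul_one (monomial (permExponent Z π) (1 : K)), ← C_mul_monomial, h1, h2, map_prod, map_prod,
    ← Finset.prod_filter_mul_prod_filter_not Finset.univ (fun i => Z (π i, i))]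
  congr 1
  · refine Finset.prod_congr rfl fun i hi => ?_
    rw [Matrix.mvPolynomialX_apply, splitVars, aeval_X, if_pos (by simpa using hi)]
  · refine Finset.prod_congr rfl fun i hi => ?_
    rw [Matrix.mvPolynomialX_apply, splitVars, aeval_X, if_neg (by simpa using hi)]

/-- If the permanent has a family of permutation monomials whose parts inside and outside `Z`
cannot be recombined, then the coefficients of the parts outside `Z` are independent. -/
lemma linearIndependent_coeff_permPoly (K : Type*) [CommRing K] {ι : Type*}
    (ρ : ι → Equiv.Perm (Fin n))
    (hρ : ∀ P Q π, permExponent (fun x => ¬ Z x) π = permExponent (fun x => ¬ Z x) (ρ P) →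
      permExponent Z π = permExponent Z (ρ Q) → P = Q) :
    LinearIndependent K fun P =>
      coeff (permExponent (fun x => ¬ Z x) (ρ P)) (splitVars K Z (permPoly n K)) := by
  classical
  -- Extracting the inner monomials of the `ρ Q` turns the family into the identity matrix: an entry
  -- counts the permutations with the outer part of `ρ P` and the inner part of `ρ Q`.
  have key : ∀ P Q, coeff (permExponent Z (ρ Q)) (coeff (permExponent (fun x => ¬ Z x) (ρ P))
      (splitVars K Z (permPoly n K))) = if P = Q then 1 else 0 := by
    intro P Q
    rw [splitVars_permPoly, coeff_sum, coeff_sum]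
    by_cases h : P = Q
    · subst h
      rw [Finset.sum_eq_single (ρ P)]
      · simp
      · intro π _ hπ
        rw [coeff_monomial]
        split_ifs with h1
        · rw [coeff_monomial, if_neg]
          exact fun h2 => hπ (eq_of_permExponent_eq Z h2 h1)
        · simp
      · simp
    · rw [if_neg h]
      refine Finset.sum_eq_zero fun π _ => ?_
      rw [coeff_monomial]
      split_ifs with h1
      · rw [coeff_monomial, if_neg]
        exact fun h2 => h (hρ P Q π h1 h2)
      · simp
  rw [linearIndependent_iff']
  intro S g hg Q hQ
  have := congrArg (coeff (permExponent Z (ρ Q))) hg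
  simpa [coeff_sum, coeff_smul, key, Finset.sum_ite_eq', hQ] using this

end Permanent

/-! ### Hub positions and 3-cycles -/

/-- The positions on the diagonal and in the rows and columns of `H`. -/
def IsHubPosition {n : ℕ} (H : Finset (Fin n)) (x : Fin n × Fin n) : Prop :=
  x.1 = x.2 ∨ x.1 ∈ H ∨ x.2 ∈ H

instance {n : ℕ} (H : Finset (Fin n)) : DecidablePred (IsHubPosition H) :=
  fun x => inferInstanceAs (Decidable (x.1 = x.2 ∨ x.1 ∈ H ∨ x.2 ∈ H))

lemma card_isHubPosition_le {n : ℕ} (H : Finset (Fin n)) :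
    (Finset.univ.filter (IsHubPosition H)).card ≤ n + 2 * (H.card * n) := by
  have hsub : Finset.univ.filter (IsHubPosition H) ⊆
      Finset.univ.diag ∪ (H ×ˢ Finset.univ ∪ Finset.univ ×ˢ H) := by
    intro x hx
    simpa [IsHubPosition] using hx
  calc _ ≤ _ := Finset.card_le_card hsub
    _ ≤ (Finset.univ : Finset (Fin n)).diag.card +
        ((H ×ˢ (Finset.univ : Finset (Fin n))).card +
          ((Finset.univ : Finset (Fin n)) ×ˢ H).card) :=
      (Finset.card_union_le _ _).trans (Nat.add_le_add_left (Finset.card_union_le _ _) _)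
    _ = _ := by simp [Finset.card_product]; ring

section Cycles

variable {k m : ℕ}

/-- In each of `k` blocks, the 3-cycle through the hub `none`, a left point and a right point. -/
def blockCycles (P : Fin k → Fin m × Fin m) :
    Equiv.Perm (Fin k × Option (Fin m ⊕ Fin m)) :=
  Equiv.prodCongrRight fun g =>
    -- The right factor acts first, giving left ↦ right ↦ hub ↦ left.
    Equiv.swap none (some (Sum.inl (P g).1)) *
      Equiv.swap (some (Sum.inl (P g).1)) (some (Sum.inr (P g).2))

variable (P : Fin k → Fin m × Fin m) (g : Fin k)

lemma blockCycles_left :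
    blockCycles P (g, some (Sum.inl (P g).1)) = (g, some (Sum.inr (P g).2)) := by
  simp [blockCycles, Equiv.swap_apply_of_ne_of_ne]

lemma blockCycles_left_of_ne {a : Fin m} (h : a ≠ (P g).1) :
    blockCycles P (g, some (Sum.inl a)) = (g, some (Sum.inl a)) := by
  simp [blockCycles, Equiv.swap_apply_of_ne_of_ne, h]

lemma blockCycles_right :
    blockCycles P (g, some (Sum.inr (P g).2)) = (g, none) := by
  simp [blockCycles]

lemma blockCycles_right_of_ne {b : Fin m} (h : b ≠ (P g).2) :
    blockCycles P (g, some (Sum.inr b)) = (g, some (Sum.inr b)) := by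
  simp [blockCycles, Equiv.swap_apply_of_ne_of_ne, h]

variable {n : ℕ} (e : Fin k × Option (Fin m ⊕ Fin m) ↪ Fin n)

/-- The rows and columns of the hubs. -/
def hubs : Finset (Fin n) := Finset.univ.image fun g => e (g, none)

lemma card_hubs_le : (hubs e).card ≤ k := by
  exact Finset.card_image_le.trans (by simp)

lemma notMem_hubs (o : Fin m ⊕ Fin m) : e (g, some o) ∉ hubs e := by
  simp [hubs, e.injective.eq_iff]

/-- The image of `blockCycles P` in the permutations of `Fin n`. -/
noncomputable def embCycles : Equiv.Perm (Fin n) := (blockCycles P).viaEmbedding e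

lemma embCycles_apply (x : Fin k × Option (Fin m ⊕ Fin m)) :
    embCycles P e (e x) = e (blockCycles P x) :=
  Equiv.Perm.viaEmbedding_apply _ _ _

lemma embCycles_left :
    embCycles P e (e (g, some (Sum.inl (P g).1))) = e (g, some (Sum.inr (P g).2)) := by
  rw [embCycles_apply, blockCycles_left]

lemma not_isHubPosition_embCycles_left :
    ¬ IsHubPosition (hubs e) (embCycles P e (e (g, some (Sum.inl (P g).1))),
      e (g, some (Sum.inl (P g).1))) := by
  rw [embCycles_left, IsHubPosition]
  simp [notMem_hubs, e.injective.eq_iff]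

/-- Fixed points give diagonal positions, a hub lies in a hub column, and the chosen right point is
sent to a hub row; only the chosen left points remain. -/
lemma exists_eq_of_not_isHubPosition {i : Fin n}
    (h : ¬ IsHubPosition (hubs e) (embCycles P e i, i)) :
    ∃ g, i = e (g, some (Sum.inl (P g).1)) := by
  rw [IsHubPosition] at h
  push Not at h
  obtain ⟨h1, h2, h3⟩ := h
  by_cases hi : i ∈ Set.range e
  · obtain ⟨⟨g, o⟩, rfl⟩ := hi
    rw [embCycles_apply] at h1 h2
    match o with
    | none => exact absurd (by simp [hubs]) h3
    | some (Sum.inl a) =>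
      by_cases ha : a = (P g).1
      · exact ⟨g, by rw [ha]⟩
      · exact absurd (by rw [blockCycles_left_of_ne P g ha]) h1
    | some (Sum.inr b) =>
      by_cases hb : b = (P g).2
      · subst hb
        rw [blockCycles_right] at h2
        exact absurd (by simp [hubs]) h2
      · exact absurd (by rw [blockCycles_right_of_ne P g hb]) h1
  · exact absurd (Equiv.Perm.viaEmbedding_apply_of_notMem _ _ _ hi) h1

lemma degree_permExponent_embCycles_le :
    (permExponent (fun x => ¬ IsHubPosition (hubs e) x) (embCycles P e)).degree ≤ k := by
  rw [degree_permExponent]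
  have hsub : (Finset.univ.filter fun i => ¬ IsHubPosition (hubs e) (embCycles P e i, i)) ⊆
      Finset.univ.image fun g => e (g, some (Sum.inl (P g).1)) := by
    intro i hi
    obtain ⟨g, rfl⟩ := exists_eq_of_not_isHubPosition P e (Finset.mem_filter.1 hi).2
    simp
  simpa using (Finset.card_le_card hsub).trans Finset.card_image_le

/-- The outer part forces `π` to send the left point of `P` to its right point. A point of `P` not
chosen by `Q` is fixed by the `Q`-permutation, and this diagonal entry forces `π` to fix it. That
contradicts the value of `π` for a left point and injectivity for a right point. -/
lemma eq_of_permExponent_embCycles {P Q : Fin k → Fin m × Fin m} {π : Equiv.Perm (Fin n)}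
    (h1 : permExponent (fun x => ¬ IsHubPosition (hubs e) x) π =
      permExponent (fun x => ¬ IsHubPosition (hubs e) x) (embCycles P e))
    (h2 : permExponent (IsHubPosition (hubs e)) π =
      permExponent (IsHubPosition (hubs e)) (embCycles Q e)) : P = Q := by
  funext g
  have hP : π (e (g, some (Sum.inl (P g).1))) = e (g, some (Sum.inr (P g).2)) := by
    rw [apply_eq_of_permExponent_eq _ h1 (not_isHubPosition_embCycles_left P g e), embCycles_left]
  have hfix : ∀ x, blockCycles Q x = x → π (e x) = e x := by
    intro x hx
    have hx' : embCycles Q e (e x) = e x := by rw [embCycles_apply, hx]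
    rw [apply_eq_of_permExponent_eq _ h2 (by rw [hx']; exact Or.inl rfl), hx']
  ext1
  · by_contra hne
    have := hfix _ (blockCycles_left_of_ne Q g hne)
    rw [hP] at this
    simp [e.injective.eq_iff] at this
  · by_contra hne
    have := hfix _ (blockCycles_right_of_ne Q g hne)
    simpa [e.injective.eq_iff] using π.injective (hP.trans this.symm)

end Cycles

/-! ### Comparison of the bounds and choice of parameters -/

/-- The lower bound on the number of summands in terms of the parameters of the measure. It holds
for all products of `t` read-once polynomials, whatever their sum-fan-in. -/
lemma pow_le_of_sum_prod_eq_permPoly {K : Type*} [Field K] {n s t k m : ℕ}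
    (hkm : k * (2 * m + 1) ≤ n) (f : Fin s → Fin t → MvPolynomial (Fin n × Fin n) K)
    (hf : ∀ i j, IsROP (f i j)) (hsum : ∑ i, ∏ j, f i j = permPoly n K) :
    (m * m) ^ k ≤ s * (3 * (t * (n + 2 * (k * n))) + 1) ^ k := by
  obtain ⟨e⟩ : Nonempty (Fin k × Option (Fin m ⊕ Fin m) ↪ Fin n) := by
    apply Function.Embedding.nonempty_of_card_le
    simpa [← two_mul] using hkm
  obtain ⟨V, hVc, hV⟩ := exists_span_sum_prod (IsHubPosition (hubs e)) f hf k
  rw [hsum] at hV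
  have hli := linearIndependent_coeff_permPoly (IsHubPosition (hubs e)) K
    (fun P : Fin k → Fin m × Fin m => embCycles P e)
    (fun P Q π h1 h2 => eq_of_permExponent_embCycles e h1 h2)
  have hcard := linearIndependent_le_span' _ hli (V : Set (MvPolynomial (Fin n × Fin n) K)) (by
    rintro _ ⟨P, rfl⟩
    exact hV _ (degree_permExponent_embCycles_le P e))
  have hcard' : (m * m) ^ k ≤ V.card := by
    simp only [Cardinal.mk_fintype] at hcard
    simpa using Nat.cast_le.1 hcard
  refine hcard'.trans (hVc.trans (Nat.mul_le_mul_left _ (Nat.pow_le_pow_left ?_ _)))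
  have := card_isHubPosition_le (hubs e)
  have h2 : (hubs e).card * n ≤ k * n := Nat.mul_le_mul_right _ (card_hubs_le e)
  have h3 := Nat.mul_le_mul_left t (show (Finset.univ.filter (IsHubPosition (hubs e))).card ≤
    n + 2 * (k * n) by omega)
  omega
theorem theorem3 :
    ∃ ε : ℝ, 0 < ε ∧ ∃ c : ℝ, 0 < c ∧ ∃ n₀ : ℕ,
      ∀ (K : Type*) [Field K] (n N s t : ℕ) (lam : ℝ)
        (f : Fin s → Fin t → MvPolynomial (Fin n × Fin n) K),
        n₀ ≤ n → N = n ^ 2 → lam ≤ 1 / 30 → (t : ℝ) ≤ (N : ℝ) ^ (1 / 30 : ℝ) →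
        (∀ i j, IsROP (f i j)) →
        (∀ i j, (ropSumFanIn (f i j) : ℝ) ≤ (N : ℝ) ^ (1 / 2 + lam)) →
        ∑ i, ∏ j, f i j = permPoly n K →
        (2 : ℝ) ^ (c * (N : ℝ) ^ ε) ≤ (s : ℝ) := by
  -- With `x = n^(1/10) = N^(1/20)`, the threshold `3^10` gives `x ≥ 3`, and `c = 1/2` absorbs the
  -- rounding in `k = ⌊x⌋`.
  refine ⟨1 / 20, by norm_num, 1 / 2, by norm_num, 3 ^ 10, ?_⟩
  intro K _ n N s t lam f hn hN _ ht hf _ hsum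
  subst hN
  have hn0 : (0 : ℝ) ≤ n := n.cast_nonneg
  have hcast : ((n ^ 2 : ℕ) : ℝ) = (n : ℝ) ^ (2 : ℝ) := by push_cast; norm_cast
  set x : ℝ := (n : ℝ) ^ (1 / 10 : ℝ) with hx
  have hx3 : 3 ≤ x := by
    have h : ((3 : ℝ) ^ (10 : ℝ)) ^ (1 / 10 : ℝ) ≤ x :=
      Real.rpow_le_rpow (by positivity) (by exact_mod_cast hn) (by norm_num)
    rwa [← Real.rpow_mul (by norm_num), show (10 : ℝ) * (1 / 10) = 1 by norm_num,
      Real.rpow_one] at h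
  have hxn : x ^ 10 = n := by
    rw [hx, ← Real.rpow_natCast, ← Real.rpow_mul hn0]; norm_num
  have hN20 : ((n ^ 2 : ℕ) : ℝ) ^ (1 / 20 : ℝ) = x := by
    rw [hcast, ← Real.rpow_mul hn0, hx]; norm_num
  have htx : (t : ℝ) ≤ x := by
    refine ht.trans ?_
    rw [hcast, ← Real.rpow_mul hn0, hx]
    exact Real.rpow_le_rpow_of_exponent_le (by
      exact_mod_cast (Nat.one_le_pow 10 3 (by norm_num)).trans hn) (by norm_num)
  rw [hN20]
  set k : ℕ := ⌊x⌋₊ with hk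
  have hkx : (k : ℝ) ≤ x := Nat.floor_le (by linarith)
  have hxk : x < k + 1 := Nat.lt_floor_add_one x
  have hk1 : 1 ≤ k := by
    by_contra h
    have : k = 0 := by omega
    rw [this] at hxk
    norm_num at hxk
    linarith
  -- Since `m ≥ 1`, the `k` blocks of `2m + 1` points fit: `k(2m+1) ≤ 3km ≤ n`.
  set m : ℕ := n / (3 * k) with hm
  have hm1 : 1 ≤ m := by
    rw [hm, Nat.one_le_div_iff (by omega)]
    have : (3 * k : ℝ) ≤ n := by
      rw [← hxn]
      nlinarith [pow_le_pow_right₀ (show (1 : ℝ) ≤ x by linarith) (show 2 ≤ 10 by norm_num)]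
    exact_mod_cast this
  have hmle : 3 * k * m ≤ n := Nat.mul_div_le n (3 * k)
  have hmlt : n < 3 * k * (m + 1) := Nat.lt_mul_div_succ n (by omega)
  have hmain := pow_le_of_sum_prod_eq_permPoly (k := k) (m := m) (by nlinarith) f hf hsum
  have hn6 : n ≤ 6 * k * m := by nlinarith
  have hk1' : (1 : ℝ) ≤ k := by exact_mod_cast hk1
  have hn1 : (1 : ℝ) ≤ n := by exact_mod_cast (Nat.one_le_pow 10 3 (by norm_num)).trans hn
  have hB : ((3 * (t * (n + 2 * (k * n))) + 1 : ℕ) : ℝ) ≤ 10 * x * (k * n) := by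
    push_cast
    have h1 : (n : ℝ) ≤ k * n := by nlinarith
    have h2 : (t : ℝ) * (n + 2 * (k * n)) ≤ x * (3 * (k * n)) :=
      mul_le_mul htx (by linarith) (by positivity) (by linarith)
    have h3 : (1 : ℝ) ≤ x * (k * n) := by nlinarith
    linarith
  -- From `n ≤ 6km` this reduces to `720 x k^3 ≤ n = x^10`, which holds because `k ≤ x` and `x^6 ≥
  -- 3^6 = 729`.
  have hA : 2 * (10 * x * (k * n)) ≤ ((m * m : ℕ) : ℝ) := by
    have h1 : (n : ℝ) ≤ 6 * k * m := by exact_mod_cast hn6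
    have h2 : (n : ℝ) * n ≤ 36 * k ^ 2 * (m * m) := by nlinarith
    have h3 : (720 * x * k ^ 3 : ℝ) ≤ n := by
      have hk3 : (k : ℝ) ^ 3 ≤ x ^ 3 := pow_le_pow_left₀ (by positivity) hkx 3
      have hx6 : (3 : ℝ) ^ 6 ≤ x ^ 6 := pow_le_pow_left₀ (by norm_num) hx3 6
      calc 720 * x * (k : ℝ) ^ 3 ≤ 720 * x * x ^ 3 :=
            mul_le_mul_of_nonneg_left hk3 (by linarith)
        _ = 720 * x ^ 4 := by ring
        _ ≤ x ^ 6 * x ^ 4 := mul_le_mul_of_nonneg_right (by linarith) (by positivity)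
        _ = n := by rw [← hxn]; ring
    have h4 : 36 * (k : ℝ) ^ 2 * (2 * (10 * x * (k * n))) ≤ 36 * k ^ 2 * (m * m) := by
      have := mul_le_mul_of_nonneg_right h3 hn0
      linarith
    push_cast
    exact le_of_mul_le_mul_left h4 (by positivity)
  have hpos : (0 : ℝ) < 10 * x * (k * n) := by
    have : (0 : ℝ) < x := by linarith
    positivity
  have hs : (2 : ℝ) ^ k ≤ s := by
    refine le_of_mul_le_mul_right ?_ (pow_pos hpos k)
    calc (2 : ℝ) ^ k * (10 * x * (k * n)) ^ k = (2 * (10 * x * (k * n))) ^ k := (mul_pow _ _ _).symm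
      _ ≤ ((m * m : ℕ) : ℝ) ^ k := pow_le_pow_left₀ (by positivity) hA k
      _ ≤ s * ((3 * (t * (n + 2 * (k * n))) + 1 : ℕ) : ℝ) ^ k := by exact_mod_cast hmain
      _ ≤ s * (10 * x * (k * n)) ^ k :=
        mul_le_mul_of_nonneg_left (pow_le_pow_left₀ (by positivity) hB k) (by positivity)
  refine le_trans ?_ hs
  rw [← Real.rpow_natCast]
  exact Real.rpow_le_rpow_of_exponent_le (by norm_num) (by linarith)
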